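/- Let $m\ge 1$, $n\ge 0$ and let $\bm P=(p_{j,i})\in\mathbb N^{n\times m}$ be an instance of unrelated machine scheduling: $p_{j,i}$ is the processing time of job $j$ on machine $i$, a schedule is a map $\sigma:[n]\to[m]$, and its makespan is $\max_i\sum_{j:\sigma(j)=i}p_{j,i}$. Let $\varepsilon>0$ be real. Consider the following branch-and-bound algorithm $A^{\text{BFS-unrel}}_\varepsilon$. A node $v$ of the branching tree at depth $k$ is a sequence of fixed job-machine pairs $(j_1,i_1),\dots,(j_k,i_k)$; let $S_v=[n]\setminus\{j_1,\dots,j_k\}$ be its unfixed jobs and $t_i=\sum_{z:i_z=i}p_{j_z,i_z}$ its overheads. The root has $k=0$. *Bounding.* For $T\in\mathbb N$ let $Q_v(T)$ be the polyhedron in the variables $x_{j,i}$ ($j\in S_v$, $p_{j,i}\le T$) given by $x\ge 0$, $\sum_i x_{j,i}=1$ for all $j\in S_v$, and $\sum_j p_{j,i}x_{j,i}\le T-t_i$ for all $i\in[m]$. Let $LB(v)$ be the smallest $T\in\mathbb N$ with $Q_v(T)\neq\emptyset$, and take a vertex $x$ of $Q_v(LB(v))$. A job is fractional if some $x_{j,i}\notin\{0,1\}$.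 The rounded schedule at $v$ keeps the fixed jobs and the integral jobs of $x$, and assigns each fractional job to a machine on which its processing time is minimal. *Start.* The root is bounded. It is the only active node, and its rounded schedule is the best schedule found. *Processing.* At each step an active node $v$ of smallest depth is selected and processed (breadth-first search). If its vertex has no fractional job, $v$ is just removed from the active nodes. Otherwise a fractional job $j$ with maximal $\min_i p_{j,i}$ is chosen, and the $m$ children of $v$, the $i$-th of which fixes in addition $j$ to machine $i$, are bounded. The best schedule found is updated with the rounded schedules of the children, $v$ is removed from the active nodes, and those children whose lower bound does not exceed the makespan $LUB$ of the best schedule found become active. *Stopping.* After each processed node the algorithm stops, and returns the best schedule found, if no active node is left or if $LUB\le(1+\varepsilon)\,LLB$, where $LLB$ is the smallest lower bound of an active node. Then, whatever vertices are taken and however ties are broken, the algorithm can always be carried out, it stops after processing at most $m^{\lfloor m^2/\varepsilon\rfloor}$ nodes, and the schedule it returns has makespan at most $(1+\varepsilon)$ times the minimal makespan of a schedule. -/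

import Mathlib

noncomputable section

namespace UnrelSched

variable {n m : ℕ}

/-- The makespan of the integer schedule `σ` (job `j` is done by machine `σ j`), where `P j i` is the
processing time of job `j` on machine `i`. -/
def makespan (P : Fin n → Fin m → ℕ) (σ : Fin n → Fin m) : ℕ :=
  Finset.univ.sup fun i => ∑ j ∈ Finset.univ.filter (fun j => σ j = i), P j i

/-- The minimal processing time `min_i p_{j,i}` of job `j` (used for `0 < m` only). -/
def minTime (P : Fin n → Fin m → ℕ) (j : Fin n) : ℕ := ⨅ i, P j i

/-- The polyhedron of the relaxation with job set `S`, overheads `t` and guess `T`. Its variables are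
the `x j i` with `j ∈ S` and `p_{j,i} ≤ T`; all other coordinates are set to zero. -/
def partialLP (P : Fin n → Fin m → ℕ) (S : Finset (Fin n)) (t : Fin m → ℕ) (T : ℕ) :
    Set (Fin n → Fin m → ℝ) :=
  {x | (∀ j i, ¬ (j ∈ S ∧ P j i ≤ T) → x j i = 0) ∧
    (∀ j i, 0 ≤ x j i) ∧
    (∀ j ∈ S, ∑ i, x j i = 1) ∧
    (∀ i, ∑ j ∈ S, (P j i : ℝ) * x j i ≤ (T : ℝ) - (t i : ℝ))}

/-- Job `j` is fractional in `x`. -/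
def Fractional (x : Fin n → Fin m → ℝ) (j : Fin n) : Prop := ∃ i, x j i ≠ 0 ∧ x j i ≠ 1

/-- A node of the branching tree, given by its path from the root: the list of the (job, machine)
pairs that are fixed, the most recent one first. The root is the empty list. -/
abbrev Path (n m : ℕ) : Type := List (Fin n × Fin m)

/-- The jobs that are not fixed at a node. -/
def free (v : Path n m) : Finset (Fin n) := Finset.univ.filter fun j => j ∉ v.map Prod.fst

/-- The overheads at a node: the total time of the jobs that are fixed to machine `i`. -/
def overhead (P : Fin n → Fin m → ℕ) (v : Path n m) (i : Fin m) : ℕ :=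
  ((v.filter fun z => z.2 = i).map fun z => P z.1 z.2).sum

/-- A node with the data computed in the bounding phase: the lower bound, the vertex of the
relaxation, and the rounded integer schedule of all jobs. -/
structure Node (n m : ℕ) where
  path : Path n m
  lb : ℕ
  vertex : Fin n → Fin m → ℝ
  schedule : Fin n → Fin m

/-- The data stored in the node `v` is a correct outcome of the bounding phase:
`lb` is the smallest natural number for which the relaxation at the node is feasible, `vertex` is a
vertex of the relaxation for that guess, and `schedule` keeps the fixed jobs and the integral jobs
of the vertex and moves each fractional job to a machine where its processing time is minimal. -/
structure Node.IsBounded (P : Fin n → Fin m → ℕ) (v : Node n m) : Prop where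
  lb_least : IsLeast {T : ℕ | (partialLP P (free v.path) (overhead P v.path) T).Nonempty} v.lb
  isVertex : v.vertex ∈ (partialLP P (free v.path) (overhead P v.path) v.lb).extremePoints ℝ
  fixed : ∀ z ∈ v.path, v.schedule z.1 = z.2
  integral : ∀ j ∈ free v.path, ¬ Fractional v.vertex j → v.vertex j (v.schedule j) = 1
  fractional : ∀ j ∈ free v.path, Fractional v.vertex j → P j (v.schedule j) = minTime P j

/-- The state of the branch-and-bound algorithm: the active nodes and the best schedule found. -/
structure State (n m : ℕ) where
  active : Set (Node n m)
  best : Fin n → Fin m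

/-- At the start only the root is active, and its rounded schedule is the best one found. -/
def IsInitial (P : Fin n → Fin m → ℕ) (s : State n m) : Prop :=
  ∃ r : Node n m, r.path = [] ∧ r.IsBounded P ∧ s.active = {r} ∧ s.best = r.schedule

/-- Breadth-first selection: `v` is an active node of smallest depth. -/
def BFSSelects (s : State n m) (v : Node n m) : Prop :=
  v ∈ s.active ∧ ∀ w ∈ s.active, v.path.length ≤ w.path.length

/-- `j` is a branching job at `v`: a fractional job whose minimal processing time is maximal. -/
def IsBranchingJob (P : Fin n → Fin m → ℕ) (v : Node n m) (j : Fin n) : Prop :=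
  Fractional v.vertex j ∧ ∀ j', Fractional v.vertex j' → minTime P j' ≤ minTime P j

/-- Processing the node `v` turns the state `s` into `s'`. A node with an integral vertex is solved
and only removed. Otherwise a branching job `j` is chosen, the `m` children (child `i` fixes `j` to
machine `i`) are bounded, the best schedule is updated, and the children whose lower bound does not
exceed the makespan of the best schedule replace `v`; the other children are pruned. -/
inductive Processes (P : Fin n → Fin m → ℕ) (v : Node n m) (s s' : State n m) : Prop
  | leaf (h_integral : ∀ j, ¬ Fractional v.vertex j)
      (h_active : s'.active = s.active \ {v})
      (h_best : s'.best = s.best)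
  | branch (j : Fin n) (hj : IsBranchingJob P v j)
      (c : Fin m → Node n m)
      (h_path : ∀ i, (c i).path = (j, i) :: v.path)
      (h_bounded : ∀ i, (c i).IsBounded P)
      (h_found : s'.best = s.best ∨ ∃ i, s'.best = (c i).schedule)
      (h_best : makespan P s'.best ≤ makespan P s.best)
      (h_best_child : ∀ i, makespan P s'.best ≤ makespan P (c i).schedule)
      (h_active : s'.active =
        (s.active \ {v}) ∪ {w | (∃ i, w = c i) ∧ w.lb ≤ makespan P s'.best})

/-- One step: a node is selected by the breadth-first rule and processed. -/
def Step (P : Fin n → Fin m → ℕ) (s s' : State n m) : Prop :=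
  ∃ v, BFSSelects s v ∧ Processes P v s s'

/-- The stopping rule `LUB / LLB ≤ 1 + ε`, where `LUB` is the makespan of the best schedule found and
`LLB` is the least lower bound of an active node. It is written without division (so that `LLB = 0`
is meaningful), and the algorithm also stops when there is no active node left. -/
def Stops (P : Fin n → Fin m → ℕ) (ε : ℝ) (s : State n m) : Prop :=
  s.active = ∅ ∨
    ∃ LLB : ℕ, IsLeast (Node.lb '' s.active) LLB ∧ (makespan P s.best : ℝ) ≤ (1 + ε) * LLB

/-- `Run P ε k s`: some execution of the algorithm is in state `s` right after processing its
`k`-th node. The stopping rule is tested after each processed node. -/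
inductive Run (P : Fin n → Fin m → ℕ) (ε : ℝ) : ℕ → State n m → Prop
  | first {s s' : State n m} : IsInitial P s → Step P s s' → Run P ε 1 s'
  | next {k : ℕ} {s s' : State n m} :
      Run P ε k s → ¬ Stops P ε s → Step P s s' → Run P ε (k + 1) s'

end UnrelSched

end

namespace UnrelSched

open Finset

variable {n m : ℕ} {P : Fin n → Fin m → ℕ}

/-! The lower bound of a node bounds every schedule in its subtree and never decreases towards the
leaves, so discarding a solved or pruned node loses nothing better than the incumbent (`Invariant`).
This gives correctness on stopping.

For the node count, let `U` be the best makespan and `F = ⌊m² / ε⌋`. A vertex has at most `m`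
fractional jobs (`card_fractional_le`), so rounding costs at most `m` times the minimal time of the
branching job. Hence `U ≤ lb + m * minTime` for every job fixed on an active path and for the next
branching job. If the algorithm has not stopped, an active node of least `lb` has `U > (1 + ε) lb`,
so all these jobs have `minTime > ε lb / m`. They fit on `m` machines within time `lb`, so there are
fewer than `m² / ε` of them (`Invariant.exists_shallow`). Breadth-first search selects a node no
deeper, so every processed node after the root has depth below `F`. For `m ≥ 2` there are at most `m
^ F` such nodes; for `m = 1` nothing is ever fractional. -/

lemma minTime_le (P : Fin n → Fin m → ℕ) (j : Fin n) (i : Fin m) : minTime P j ≤ P j i :=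
  ciInf_le (OrderBot.bddBelow _) i

lemma exists_eq_minTime (hm : 0 < m) (P : Fin n → Fin m → ℕ) (j : Fin n) :
    ∃ i, P j i = minTime P j := by
  have : Nonempty (Fin m) := ⟨⟨0, hm⟩⟩
  exact Nat.sInf_mem (Set.range_nonempty fun i => P j i)

/-! ### Partial assignments and their lower bounds. -/

lemma mem_free {v : Path n m} {j : Fin n} : j ∈ free v ↔ j ∉ v.map Prod.fst := by
  simp [free]

lemma free_cons (z : Fin n × Fin m) (v : Path n m) : free (z :: v) = (free v).erase z.1 := by
  ext j
  simp only [mem_free, mem_erase, List.map_cons, List.mem_cons, not_or, ne_eq]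

lemma overhead_cons (z : Fin n × Fin m) (v : Path n m) (i : Fin m) :
    overhead P (z :: v) i = (if z.2 = i then P z.1 z.2 else 0) + overhead P v i := by
  by_cases h : z.2 = i <;> simp [overhead, h]

/-- No job is fixed twice on the path. -/
def NodupJobs (v : Path n m) : Prop := (v.map Prod.fst).Nodup

/-- The schedule `σ` respects the assignments fixed on the path. -/
def Extends (σ : Fin n → Fin m) (v : Path n m) : Prop := ∀ z ∈ v, σ z.1 = z.2

lemma nodupJobs_cons {z : Fin n × Fin m} {v : Path n m} :
    NodupJobs (z :: v) ↔ z.1 ∈ free v ∧ NodupJobs v := by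
  rw [mem_free]
  exact List.nodup_cons

lemma extends_cons {σ : Fin n → Fin m} {z : Fin n × Fin m} {v : Path n m} :
    Extends σ (z :: v) ↔ σ z.1 = z.2 ∧ Extends σ v := by
  simp only [Extends, List.forall_mem_cons]

lemma exists_extends (hm : 0 < m) {v : Path n m} (hv : NodupJobs v) :
    ∃ σ : Fin n → Fin m, Extends σ v := by
  induction v with
  | nil => exact ⟨fun _ => ⟨0, hm⟩, by simp [Extends]⟩
  | cons z v ih =>
    obtain ⟨hz, hv⟩ := nodupJobs_cons.1 hv
    obtain ⟨σ, hσ⟩ := ih hv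
    refine ⟨Function.update σ z.1 z.2, extends_cons.2 ⟨by simp, fun w hw => ?_⟩⟩
    have hne : w.1 ≠ z.1 := fun h => mem_free.1 hz (h ▸ List.mem_map_of_mem hw)
    rw [Function.update_of_ne hne, hσ w hw]

lemma load_eq {σ : Fin n → Fin m} {v : Path n m} (hv : NodupJobs v) (hσ : Extends σ v)
    (i : Fin m) :
    ∑ j ∈ univ.filter (fun j => σ j = i), P j i =
      overhead P v i + ∑ j ∈ free v, if σ j = i then P j i else 0 := by
  induction v with
  | nil => simp [overhead, free, sum_filter]
  | cons z v ih =>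
    obtain ⟨hz, hv⟩ := nodupJobs_cons.1 hv
    obtain ⟨hσz, hσ⟩ := extends_cons.1 hσ
    rw [ih hv hσ, free_cons, overhead_cons, ← add_sum_erase _ _ hz, hσz]
    by_cases h : z.2 = i
    · subst h
      simp
      ring
    · simp [h]

lemma load_le_makespan (σ : Fin n → Fin m) (i : Fin m) :
    ∑ j ∈ univ.filter (fun j => σ j = i), P j i ≤ makespan P σ :=
  le_sup (f := fun i => ∑ j ∈ univ.filter (fun j => σ j = i), P j i) (mem_univ i)

lemma partialLP_makespan_nonempty {σ : Fin n → Fin m} {v : Path n m} (hv : NodupJobs v)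
    (hσ : Extends σ v) : (partialLP P (free v) (overhead P v) (makespan P σ)).Nonempty := by
  refine ⟨fun j i => if j ∈ free v ∧ σ j = i then 1 else 0, ?_, ?_, ?_, ?_⟩
  · intro j i h
    refine if_neg ?_
    rintro ⟨hj, hi⟩
    refine h ⟨hj, le_trans ?_ (load_le_makespan σ i)⟩
    exact single_le_sum (f := fun j => P j i) (fun _ _ => Nat.zero_le _) (by simp [hi])
  · intro j i
    positivity
  · intro j hj
    simp [hj]
  · intro i
    have h := load_le_makespan (P := P) σ i
    rw [load_eq hv hσ] at h
    have h' : ((overhead P v i : ℕ) : ℝ) + ∑ j ∈ free v, (if σ j = i then (P j i : ℝ) else 0)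
        ≤ makespan P σ := by exact_mod_cast h
    have : ∑ j ∈ free v, (P j i : ℝ) * (if j ∈ free v ∧ σ j = i then 1 else 0)
        = ∑ j ∈ free v, (if σ j = i then (P j i : ℝ) else 0) :=
      sum_congr rfl fun j hj => by simp [hj]
    rw [this]
    linarith

lemma Node.IsBounded.lb_le_makespan {v : Node n m} (hb : v.IsBounded P) (hv : NodupJobs v.path)
    {σ : Fin n → Fin m} (hσ : Extends σ v.path) : v.lb ≤ makespan P σ :=
  hb.lb_least.2 (partialLP_makespan_nonempty hv hσ)

/-- Unfixing a job turns its share of the overhead into an integral row of the relaxation. This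
makes lower bounds monotone along the tree. -/
lemma partialLP_nonempty_of_cons {z : Fin n × Fin m} {v : Path n m} (hz : z.1 ∈ free v) {T : ℕ}
    (h : (partialLP P (free (z :: v)) (overhead P (z :: v)) T).Nonempty) :
    (partialLP P (free v) (overhead P v) T).Nonempty := by
  obtain ⟨x, h0, hnn, h1, hT⟩ := h
  have hxz : ∀ i, x z.1 i = 0 := fun i => h0 _ _ (by simp [free_cons])
  -- The variable for this pair must exist in the parent's relaxation; the child's load constraint
  -- forces it, since its overhead includes this time.
  have hPz : P z.1 z.2 ≤ T := by
    have h := hT z.2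
    have : 0 ≤ ∑ j ∈ free (z :: v), (P j z.2 : ℝ) * x j z.2 :=
      sum_nonneg fun j _ => mul_nonneg (Nat.cast_nonneg _) (hnn _ _)
    rw [overhead_cons, if_pos rfl] at h
    push_cast at h
    have h2 : (0 : ℝ) ≤ overhead P v z.2 := Nat.cast_nonneg _
    exact_mod_cast (by linarith : (P z.1 z.2 : ℝ) ≤ T)
  refine ⟨Function.update x z.1 (Pi.single z.2 1), ?_, ?_, ?_, ?_⟩
  · intro j i hji
    by_cases hj : j = z.1
    · subst hj
      have : i ≠ z.2 := by
        rintro rfl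
        exact hji ⟨hz, hPz⟩
      simp [this]
    · rw [Function.update_of_ne hj]
      refine h0 _ _ fun h => hji ⟨?_, h.2⟩
      have := h.1
      rw [free_cons] at this
      exact mem_of_mem_erase this
  · intro j i
    by_cases hj : j = z.1
    · subst hj
      rw [Function.update_self, Pi.single_apply]
      positivity
    · rw [Function.update_of_ne hj]
      exact hnn j i
  · intro j hjf
    by_cases hj : j = z.1
    · subst hj
      simp
    · rw [Function.update_of_ne hj]
      exact h1 j (by rw [free_cons]; exact mem_erase.2 ⟨hj, hjf⟩)
  · intro i
    have h := hT i
    rw [overhead_cons, free_cons] at h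
    rw [← add_sum_erase _ _ hz, Function.update_self, Pi.single_apply]
    have : ∑ j ∈ (free v).erase z.1, (P j i : ℝ) * Function.update x z.1 (Pi.single z.2 1) j i
        = ∑ j ∈ (free v).erase z.1, (P j i : ℝ) * x j i :=
      sum_congr rfl fun j hj => by rw [Function.update_of_ne (ne_of_mem_erase hj)]
    rw [this]
    by_cases hi : z.2 = i
    · subst hi
      simp at h ⊢
      linarith
    · simp [hi, Ne.symm hi] at h ⊢
      linarith

lemma Node.IsBounded.lb_le_of_cons {v c : Node n m} (hv : v.IsBounded P) (hc : c.IsBounded P)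
    {z : Fin n × Fin m} (hz : z.1 ∈ free v.path) (hp : c.path = z :: v.path) : v.lb ≤ c.lb := by
  refine hv.lb_least.2 (partialLP_nonempty_of_cons hz ?_)
  rw [← hp]
  exact hc.lb_least.1

/-! ### Vertices have few fractional jobs. -/

lemma mem_of_fractional {S : Finset (Fin n)} {t : Fin m → ℕ} {T : ℕ} {x : Fin n → Fin m → ℝ}
    (hx : x ∈ partialLP P S t T) {j : Fin n} (hj : Fractional x j) : j ∈ S := by
  obtain ⟨i, hi, -⟩ := hj
  by_contra h
  exact hi (hx.1 j i fun h' => h h'.1)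

lemma exists_pair_of_fractional {S : Finset (Fin n)} {t : Fin m → ℕ} {T : ℕ}
    {x : Fin n → Fin m → ℝ} (hx : x ∈ partialLP P S t T) {j : Fin n} (hj : Fractional x j) :
    ∃ a b, a ≠ b ∧ 0 < x j a ∧ 0 < x j b := by
  have hjS := mem_of_fractional hx hj
  obtain ⟨a, ha0, ha1⟩ := hj
  obtain ⟨-, hnn, h1, -⟩ := hx
  by_contra! h
  have hz : ∀ b ≠ a, x j b = 0 := fun b hb =>
    le_antisymm (h a b hb.symm (lt_of_le_of_ne (hnn j a) ha0.symm)) (hnn j b)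
  have := h1 j hjS
  rw [Fintype.sum_eq_single a fun b hb => hz b hb] at this
  exact ha1 this

lemma exists_pos_mul_abs_le {ι : Type*} [Finite ι] (x y : ι → ℝ) (hx : ∀ k, 0 ≤ x k)
    (h : ∀ k, y k ≠ 0 → 0 < x k) : ∃ δ : ℝ, 0 < δ ∧ ∀ k, δ * |y k| ≤ x k := by
  have : ∀ᶠ δ : ℝ in nhdsWithin 0 (Set.Ioi 0), ∀ k, δ * |y k| ≤ x k := by
    rw [Filter.eventually_all]
    intro k
    by_cases hk : y k = 0
    · simp [hk, hx k]
    · have hc : Filter.Tendsto (fun δ : ℝ => δ * |y k|) (nhdsWithin 0 (Set.Ioi 0)) (nhds 0) := by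
        have : Continuous fun δ : ℝ => δ * |y k| := by fun_prop
        simpa [ContinuousWithinAt] using this.continuousWithinAt (s := Set.Ioi 0) (x := 0)
      filter_upwards [hc.eventually (gt_mem_nhds (h k hk))] with δ hδ using hδ.le
  obtain ⟨δ, hδ, h0⟩ := (this.and self_mem_nhdsWithin).exists
  exact ⟨δ, h0, hδ⟩

open Classical in
/-- A vertex of the relaxation has at most `m` fractional jobs. -/
lemma card_fractional_le {S : Finset (Fin n)} {t : Fin m → ℕ} {T : ℕ} {x : Fin n → Fin m → ℝ}
    (hx : x ∈ (partialLP P S t T).extremePoints ℝ) :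
    (univ.filter fun j => Fractional x j).card ≤ m := by
  by_contra! hcard
  obtain ⟨hxm, hext⟩ := mem_extremePoints_iff_left.1 hx
  have : Nonempty (Fin m) := by
    obtain ⟨j, hj⟩ := card_pos.1 (Nat.zero_lt_of_lt hcard)
    exact ⟨(mem_filter.1 hj).2.choose⟩
  choose! a b hab ha hb using fun j (hj : Fractional x j) => exists_pair_of_fractional hxm hj
  -- Moving mass of `j` from `b j` to `a j` keeps its row sum. More than `m` such moves have
  -- linearly dependent effects on the `m` loads, so some nonzero combination `y` changes no load.
  let D : Fin n → Fin m → ℝ := fun j => Pi.single (a j) 1 - Pi.single (b j) 1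
  let L : ({j // Fractional x j} → ℝ) →ₗ[ℝ] (Fin m → ℝ) :=
    Fintype.linearCombination ℝ fun (j : {j // Fractional x j}) i => (P j i : ℝ) * D j i
  have hker : LinearMap.ker L ≠ ⊥ := by
    apply LinearMap.ker_ne_bot_of_finrank_lt
    simpa [Fintype.card_subtype] using hcard
  obtain ⟨α, hα, hα0⟩ := (Submodule.ne_bot_iff _).1 hker
  let β : Fin n → ℝ := fun j => if h : Fractional x j then α ⟨j, h⟩ else 0
  let y : Fin n → Fin m → ℝ := fun j i => β j * D j i
  have hβ : ∀ j, ¬ Fractional x j → β j = 0 := fun j hj => dif_neg hj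
  have hrow : ∀ i, ∑ j ∈ S, (P j i : ℝ) * y j i = 0 := by
    intro i
    have h : ∑ j : {j // Fractional x j}, α j * ((P j i : ℝ) * D j i) = 0 := by
      have := congrFun (LinearMap.mem_ker.1 hα) i
      simpa [L, Fintype.linearCombination_apply, Finset.sum_apply] using this
    have h2 : ∑ j : {j // Fractional x j}, (P j i : ℝ) * y j i = 0 := by
      rw [← h]
      refine sum_congr rfl fun j _ => ?_
      simp only [y, β, dif_pos j.2]
      ring
    rw [← h2, ← sum_subtype (univ.filter fun j => Fractional x j) (by simp)
      fun j => (P j i : ℝ) * y j i]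
    symm
    refine sum_subset (fun j hj => mem_of_fractional hxm (mem_filter.1 hj).2) fun j _ hj => ?_
    simp [y, hβ j (by simpa using hj)]
  have hsum : ∀ j, ∑ i, y j i = 0 := fun j => by
    simp [y, D, ← mul_sum]
  have hpos : ∀ k : Fin n × Fin m, y k.1 k.2 ≠ 0 → 0 < x k.1 k.2 := by
    rintro ⟨j, i⟩ hy
    have hf : Fractional x j := by
      by_contra hf
      simp [y, hβ j hf] at hy
    by_cases hia : i = a j
    · exact hia ▸ ha j hf
    by_cases hib : i = b j
    · exact hib ▸ hb j hf
    simp [y, D, hia, hib] at hy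
  obtain ⟨δ, hδ, hδx⟩ := exists_pos_mul_abs_le (fun k : Fin n × Fin m => x k.1 k.2)
    (fun k => y k.1 k.2) (fun k => hxm.2.1 _ _) hpos
  have hmem : ∀ s : ℝ, |s| = δ → x + s • y ∈ partialLP P S t T := by
    intro s hs
    refine ⟨fun j i h => ?_, fun j i => ?_, fun j hj => ?_, fun i => ?_⟩
    · have hx0 := hxm.1 j i h
      have hy0 : y j i = 0 := by
        by_contra hy
        exact (hpos (j, i) hy).ne' hx0
      simp [hx0, hy0]
    · have h1 := hδx (j, i)
      rw [← hs, ← abs_mul] at h1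
      have h2 := neg_abs_le (s * y j i)
      simp only [Pi.add_apply, Pi.smul_apply, smul_eq_mul]
      simp only at h1
      linarith
    · simp [sum_add_distrib, ← mul_sum, hsum, hxm.2.2.1 j hj]
    · have : ∑ j ∈ S, (P j i : ℝ) * (x + s • y) j i
          = ∑ j ∈ S, (P j i : ℝ) * x j i + s * ∑ j ∈ S, (P j i : ℝ) * y j i := by
        rw [mul_sum, ← sum_add_distrib]
        refine sum_congr rfl fun j _ => ?_
        simp only [Pi.add_apply, Pi.smul_apply, smul_eq_mul]
        ring
      rw [this, hrow, mul_zero, add_zero]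
      exact hxm.2.2.2 i
  -- `x` is the midpoint of the feasible points `x ± δ y`, so `y` must vanish. Its entries at `a j`
  -- recover `α`, because `a j ≠ b j`.
  have heq := hext _ (hmem δ (abs_of_pos hδ)) _ (hmem (-δ) (by simp [abs_of_pos hδ]))
    ⟨1 / 2, 1 / 2, by norm_num, by norm_num, by norm_num, by
      ext j i
      simp only [Pi.add_apply, Pi.smul_apply, smul_eq_mul]
      ring⟩
  apply hα0
  ext ⟨j, hj⟩
  have h := congrFun (congrFun heq j) (a j)
  have h2 : δ * y j (a j) = 0 := by
    simpa using h
  have h3 : y j (a j) = α ⟨j, hj⟩ := by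
    simp [y, D, β, hj, hab j hj]
  rw [h3] at h2
  exact (mul_eq_zero.1 h2).resolve_left hδ.ne'

/-! ### Rounding error and total work. -/

open Classical in
-- Integral jobs load a machine exactly as in the vertex; each fractional job adds at most its
-- minimal time.
lemma Node.IsBounded.makespan_le_sum {v : Node n m} (hb : v.IsBounded P)
    (hv : NodupJobs v.path) :
    makespan P v.schedule ≤ v.lb + ∑ j ∈ univ.filter (Fractional v.vertex), minTime P j := by
  refine Finset.sup_le fun i _ => ?_
  rw [load_eq hv hb.fixed]
  have hxm := hb.isVertex.1
  have hterm : ∀ j ∈ free v.path, (if v.schedule j = i then (P j i : ℝ) else 0) ≤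
      (P j i : ℝ) * v.vertex j i + if Fractional v.vertex j then (minTime P j : ℝ) else 0 := by
    intro j hj
    have hnn : 0 ≤ (P j i : ℝ) * v.vertex j i := mul_nonneg (Nat.cast_nonneg _) (hxm.2.1 _ _)
    by_cases hi : v.schedule j = i
    · by_cases hf : Fractional v.vertex j
      · have := hb.fractional j hj hf
        rw [hi] at this
        simp only [hi, hf, if_true, this]
        rw [this] at hnn
        linarith
      · have := hb.integral j hj hf
        rw [hi] at this
        simp [hi, hf, this]
    · rw [if_neg hi]
      positivity
  have h1 := sum_le_sum hterm
  rw [sum_add_distrib] at h1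
  have h2 := hxm.2.2.2 i
  have h3 : ∑ j ∈ free v.path, (if Fractional v.vertex j then (minTime P j : ℝ) else 0)
      = ∑ j ∈ univ.filter (Fractional v.vertex), (minTime P j : ℝ) := by
    rw [← sum_filter]
    refine sum_congr ?_ fun _ _ => rfl
    ext j
    simp only [mem_filter, mem_univ, true_and, and_iff_right_iff_imp]
    exact mem_of_fractional hxm
  rw [h3] at h1
  have : ((overhead P v.path i : ℕ) : ℝ) +
      ∑ j ∈ free v.path, (if v.schedule j = i then (P j i : ℝ) else 0) ≤
      v.lb + ∑ j ∈ univ.filter (Fractional v.vertex), (minTime P j : ℝ) := by linarith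
  exact_mod_cast this

lemma Node.IsBounded.makespan_le_lb {v : Node n m} (hb : v.IsBounded P)
    (hv : NodupJobs v.path) (hf : ∀ j, ¬ Fractional v.vertex j) :
    makespan P v.schedule ≤ v.lb := by
  simpa [hf] using hb.makespan_le_sum hv

lemma Node.IsBounded.makespan_le {v : Node n m} (hb : v.IsBounded P)
    (hv : NodupJobs v.path) {j : Fin n} (hj : IsBranchingJob P v j) :
    makespan P v.schedule ≤ v.lb + m * minTime P j := by
  classical
  refine (hb.makespan_le_sum hv).trans (Nat.add_le_add_left ?_ _)
  refine (sum_le_card_nsmul _ _ (minTime P j) fun j' hj' => hj.2 j' (by simpa using hj')).trans ?_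
  rw [smul_eq_mul]
  exact Nat.mul_le_mul_right _ (card_fractional_le hb.isVertex)

lemma sum_minTime_le_sum_overhead (v : Path n m) :
    (v.map fun z => minTime P z.1).sum ≤ ∑ i, overhead P v i := by
  induction v with
  | nil => simp
  | cons z v ih =>
    simp only [overhead_cons, sum_add_distrib, sum_ite_eq, mem_univ, if_true, List.map_cons,
      List.sum_cons]
    exact Nat.add_le_add (minTime_le P _ _) ih

/-- The fixed jobs and any one free job have total minimal time at most `m` times the bound. -/
lemma Node.IsBounded.sum_minTime_le {v : Node n m} (hb : v.IsBounded P) {j : Fin n}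
    (hj : j ∈ free v.path) :
    (v.path.map fun z => minTime P z.1).sum + minTime P j ≤ m * v.lb := by
  obtain ⟨-, hnn, h1, hT⟩ := hb.isVertex.1
  have hs : (minTime P j : ℝ) ≤ ∑ i, ∑ j ∈ free v.path, (P j i : ℝ) * v.vertex j i := by
    rw [← mul_one (minTime P j : ℝ), ← h1 j hj, mul_sum]
    refine sum_le_sum fun i _ => ?_
    refine le_trans ?_ (single_le_sum (f := fun j => (P j i : ℝ) * v.vertex j i)
      (fun j _ => mul_nonneg (Nat.cast_nonneg _) (hnn _ _)) hj)
    exact mul_le_mul_of_nonneg_right (by exact_mod_cast minTime_le P j i) (hnn _ _)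
  have h2 := sum_le_sum fun i (_ : i ∈ univ) => hT i
  simp only [sum_sub_distrib, sum_const, card_univ, Fintype.card_fin, nsmul_eq_mul] at h2
  have h3 : ((v.path.map fun z => minTime P z.1).sum : ℝ) ≤ ∑ i, (overhead P v.path i : ℝ) := by
    exact_mod_cast sum_minTime_le_sum_overhead (P := P) v.path
  have h4 : ((v.path.map fun z => minTime P z.1).sum : ℝ) + minTime P j ≤ m * v.lb := by linarith
  exact_mod_cast h4

end UnrelSched

namespace UnrelSched

open Finset

variable {n m : ℕ} {P : Fin n → Fin m → ℕ} {ε : ℝ}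

/-! ### Existence of a bounding outcome. -/

/-- Compactness yields a vertex of every nonempty relaxation, by the Krein–Milman theorem. -/
lemma isCompact_partialLP (S : Finset (Fin n)) (t : Fin m → ℕ) (T : ℕ) :
    IsCompact (partialLP P S t T) := by
  have hsub : partialLP P S t T ⊆ Set.Icc 0 1 := by
    rintro x ⟨h0, hnn, h1, -⟩
    refine ⟨hnn, fun j i => ?_⟩
    by_cases hj : j ∈ S
    · exact (single_le_sum (fun i _ => hnn j i) (mem_univ i)).trans (h1 j hj).le
    · simp [h0 j i fun h => hj h.1]
  refine isCompact_Icc.of_isClosed_subset ?_ hsub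
  simp only [partialLP, Set.ofPred_and, Set.ofPred_forall]
  have hc : ∀ j i, Continuous fun x : Fin n → Fin m → ℝ => x j i := fun j i => by fun_prop
  refine IsClosed.inter ?_ (IsClosed.inter ?_ (IsClosed.inter ?_ ?_))
  · exact isClosed_iInter fun j => isClosed_iInter fun i => isClosed_iInter fun _ =>
      isClosed_eq (hc j i) continuous_const
  · exact isClosed_iInter fun j => isClosed_iInter fun i => isClosed_le continuous_const (hc j i)
  · exact isClosed_iInter fun j => isClosed_iInter fun _ =>
      isClosed_eq (continuous_finsetSum _ fun i _ => hc j i) continuous_const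
  · exact isClosed_iInter fun i =>
      isClosed_le (continuous_finsetSum _ fun j _ => continuous_const.mul (hc j i)) continuous_const

lemma exists_eq_one_of_not_fractional {S : Finset (Fin n)} {t : Fin m → ℕ} {T : ℕ}
    {x : Fin n → Fin m → ℝ} (hx : x ∈ partialLP P S t T) {j : Fin n} (hj : j ∈ S)
    (hf : ¬ Fractional x j) : ∃ i, x j i = 1 := by
  by_contra! h
  have h0 : ∀ i, x j i = 0 := fun i => by
    by_contra hi
    exact hf ⟨i, hi, h i⟩
  have := hx.2.2.1 j hj
  simp [h0] at this

/-- The bounding phase can always be carried out. -/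
lemma exists_isBounded (hm : 0 < m) (P : Fin n → Fin m → ℕ) {p : Path n m} (hp : NodupJobs p) :
    ∃ v : Node n m, v.path = p ∧ v.IsBounded P := by
  classical
  obtain ⟨σ, hσ⟩ := exists_extends hm hp
  let A : Set ℕ := {T : ℕ | (partialLP P (free p) (overhead P p) T).Nonempty}
  have hA : A.Nonempty := ⟨_, partialLP_makespan_nonempty hp hσ⟩
  have hleast : IsLeast A (sInf A) := ⟨Nat.sInf_mem hA, fun T hT => Nat.sInf_le hT⟩
  obtain ⟨x, hx⟩ := (isCompact_partialLP (P := P) (free p) (overhead P p)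
    (sInf A)).extremePoints_nonempty hleast.1
  have hτ : ∀ j, ∃ i, (j ∉ free p → i = σ j) ∧ (j ∈ free p → ¬ Fractional x j → x j i = 1) ∧
      (j ∈ free p → Fractional x j → P j i = minTime P j) := by
    intro j
    by_cases hj : j ∈ free p
    · by_cases hf : Fractional x j
      · obtain ⟨i, hi⟩ := exists_eq_minTime hm P j
        exact ⟨i, by simp [hj], by simp [hf], fun _ _ => hi⟩
      · obtain ⟨i, hi⟩ := exists_eq_one_of_not_fractional hx.1 hj hf
        exact ⟨i, by simp [hj], fun _ _ => hi, by simp [hf]⟩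
    · exact ⟨σ j, by simp [hj]⟩
  choose τ h1 h2 h3 using hτ
  refine ⟨⟨p, sInf A, x, τ⟩, rfl, hleast, hx, fun z hz => ?_, h2, h3⟩
  rw [← hσ z hz]
  exact h1 z.1 fun h => mem_free.1 h (List.mem_map_of_mem hz)

/-! ### Invariants, correctness and progress. -/

/-- What is known about an active node when the best makespan found is `U`. -/
structure NodeInvariant (P : Fin n → Fin m → ℕ) (U : ℕ) (w : Node n m) : Prop where
  bounded : w.IsBounded P
  nodup : NodupJobs w.path
  le_schedule : U ≤ makespan P w.schedule
  le_path : ∀ z ∈ w.path, U ≤ w.lb + m * minTime P z.1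

lemma NodeInvariant.mono {U U' : ℕ} {w : Node n m} (h : NodeInvariant P U w) (hU : U' ≤ U) :
    NodeInvariant P U' w :=
  ⟨h.bounded, h.nodup, hU.trans h.le_schedule, fun z hz => hU.trans (h.le_path z hz)⟩

lemma IsBranchingJob.mem_free {v : Node n m} (hv : v.IsBounded P) {j : Fin n}
    (hj : IsBranchingJob P v j) : j ∈ free v.path :=
  mem_of_fractional hv.isVertex.1 hj.1

/-- For the newly fixed job, the incumbent is at most the parent's rounded makespan, hence at most
`v.lb + m * minTime P j`. Older path bounds survive because `lb` grows and `U` shrinks. -/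
lemma NodeInvariant.child {U U' : ℕ} {v c : Node n m} (hv : NodeInvariant P U v) (hU : U' ≤ U)
    {j : Fin n} (hj : IsBranchingJob P v j) {i : Fin m} (hp : c.path = (j, i) :: v.path)
    (hc : c.IsBounded P) (hUc : U' ≤ makespan P c.schedule) : NodeInvariant P U' c := by
  have hjf := hj.mem_free hv.bounded
  have hlb : v.lb ≤ c.lb := hv.bounded.lb_le_of_cons hc (z := (j, i)) hjf hp
  refine ⟨hc, hp ▸ nodupJobs_cons.2 ⟨hjf, hv.nodup⟩, hUc, ?_⟩
  rw [hp, List.forall_mem_cons]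
  refine ⟨?_, fun z hz => ?_⟩
  · have := hv.bounded.makespan_le hv.nodup hj
    have := hv.le_schedule
    simp only
    omega
  · have := hv.le_path z hz
    omega

/-- The invariant of the algorithm: each schedule is either not better than the best one found, or it
belongs to the subtree of an active node. -/
structure Invariant (P : Fin n → Fin m → ℕ) (s : State n m) : Prop where
  node : ∀ w ∈ s.active, NodeInvariant P (makespan P s.best) w
  cover : ∀ σ, makespan P s.best ≤ makespan P σ ∨ ∃ w ∈ s.active, Extends σ w.path

lemma IsInitial.invariant {s : State n m} (h : IsInitial P s) : Invariant P s := by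
  obtain ⟨r, hr, hb, ha, hbest⟩ := h
  refine ⟨fun w hw => ?_, fun σ => Or.inr ⟨r, by simp [ha], by simp [hr, Extends]⟩⟩
  rw [ha, Set.mem_singleton_iff] at hw
  subst hw
  exact ⟨hb, by simp [hr, NodupJobs], by rw [hbest], by simp [hr]⟩

lemma Invariant.step {s s' : State n m} (h : Invariant P s) (hs : Step P s s') :
    Invariant P s' := by
  obtain ⟨v, ⟨hvs, -⟩, hp⟩ := hs
  have hv := h.node v hvs
  cases hp with
  | leaf hint hact hbest =>
    refine ⟨fun w hw => ?_, fun σ => ?_⟩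
    · rw [hact] at hw
      exact hbest ▸ h.node w hw.1
    · rw [hbest, hact]
      refine (h.cover σ).elim Or.inl ?_
      rintro ⟨w, hw, hσ⟩
      by_cases hwv : w = v
      -- The integral vertex rounds without loss, so the node's own schedule is optimal in its
      -- subtree and the incumbent is at least as good.
      · subst hwv
        exact Or.inl (hv.le_schedule.trans ((hv.bounded.makespan_le_lb hv.nodup hint).trans
          (hv.bounded.lb_le_makespan hv.nodup hσ)))
      · exact Or.inr ⟨w, ⟨hw, hwv⟩, hσ⟩
  | branch j hj c hpath hbd hfound hbest hbestc hact =>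
    have hc : ∀ i, NodeInvariant P (makespan P s'.best) (c i) := fun i =>
      hv.child hbest hj (hpath i) (hbd i) (hbestc i)
    refine ⟨fun w hw => ?_, fun σ => ?_⟩
    · rw [hact] at hw
      obtain hw | ⟨⟨i, rfl⟩, -⟩ := hw
      · exact (h.node w hw.1).mono hbest
      · exact hc i
    · rw [hact]
      refine (h.cover σ).elim (fun h => Or.inl (hbest.trans h)) ?_
      rintro ⟨w, hw, hσ⟩
      by_cases hwv : w = v
      · subst hwv
        have hσc : Extends σ (c (σ j)).path := by
          rw [hpath]
          exact extends_cons.2 ⟨rfl, hσ⟩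
        by_cases hl : (c (σ j)).lb ≤ makespan P s'.best
        · exact Or.inr ⟨c (σ j), Or.inr ⟨⟨σ j, rfl⟩, hl⟩, hσc⟩
        · exact Or.inl ((not_le.1 hl).le.trans
            ((hc _).bounded.lb_le_makespan (hc _).nodup hσc))
      · exact Or.inr ⟨w, Or.inl ⟨hw, hwv⟩, hσ⟩

lemma Run.invariant {k : ℕ} {s : State n m} (h : Run P ε k s) : Invariant P s := by
  induction h with
  | first hi hs => exact hi.invariant.step hs
  | next _ _ hs ih => exact ih.step hs

lemma Invariant.makespan_le_of_stops (hε : 0 < ε) {s : State n m} (h : Invariant P s)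
    (hs : Stops P ε s) (σ : Fin n → Fin m) :
    (makespan P s.best : ℝ) ≤ (1 + ε) * makespan P σ := by
  obtain h1 | ⟨w, hw, hσ⟩ := h.cover σ
  · have h1 : (makespan P s.best : ℝ) ≤ makespan P σ := by exact_mod_cast h1
    have := mul_nonneg hε.le (Nat.cast_nonneg (α := ℝ) (makespan P σ))
    linarith
  · obtain h0 | ⟨L, hL, hle⟩ := hs
    · simp [h0] at hw
    · have h2 : L ≤ makespan P σ := (hL.2 ⟨w, hw, rfl⟩).trans
        ((h.node w hw).bounded.lb_le_makespan (h.node w hw).nodup hσ)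
      refine hle.trans (mul_le_mul_of_nonneg_left (by exact_mod_cast h2) (by linarith))

lemma exists_isBranchingJob {v : Node n m} (h : ∃ j, Fractional v.vertex j) :
    ∃ j, IsBranchingJob P v j := by
  classical
  obtain ⟨j, hj, hmax⟩ := exists_max_image (univ.filter (Fractional v.vertex)) (minTime P)
    (by simpa [Finset.Nonempty] using h)
  exact ⟨j, by simpa using hj, fun j' hj' => hmax j' (by simpa using hj')⟩

lemma Invariant.exists_step (hm : 0 < m) {s : State n m} (h : Invariant P s)
    (hne : s.active.Nonempty) : ∃ s', Step P s s' := by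
  classical
  obtain ⟨v, hv, hmin⟩ : ∃ v, BFSSelects s v := by
    obtain ⟨_, ⟨v, hv, rfl⟩, hle⟩ : ∃ d, IsLeast ((fun w : Node n m => w.path.length) '' s.active) d :=
      ⟨_, Nat.sInf_mem (hne.image _), fun _ hd => Nat.sInf_le hd⟩
    exact ⟨v, hv, fun w hw => hle ⟨w, hw, rfl⟩⟩
  by_cases hf : ∃ j, Fractional v.vertex j
  · obtain ⟨j, hj⟩ := exists_isBranchingJob (P := P) hf
    have hvi := h.node v hv
    have hc : ∀ i : Fin m, ∃ c : Node n m, c.path = (j, i) :: v.path ∧ c.IsBounded P := fun i =>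
      exists_isBounded hm P (nodupJobs_cons.2 ⟨hj.mem_free hvi.bounded, hvi.nodup⟩)
    choose c hp hb using hc
    -- `none` stands for the old incumbent, so one minimum over `Option (Fin m)` meets all update
    -- conditions.
    let f : Option (Fin m) → Fin n → Fin m := fun o => o.elim s.best fun i => (c i).schedule
    obtain ⟨o, hmin'⟩ := Finite.exists_min fun o => makespan P (f o)
    refine ⟨⟨(s.active \ {v}) ∪ {w | (∃ i, w = c i) ∧ w.lb ≤ makespan P (f o)}, f o⟩, v,
      ⟨hv, hmin⟩, Processes.branch j hj c hp hb ?_ (hmin' none) (fun i => hmin' (some i)) rfl⟩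
    cases o with
    | none => exact Or.inl rfl
    | some i => exact Or.inr ⟨i, rfl⟩
  · exact ⟨⟨s.active \ {v}, s.best⟩, v, ⟨hv, hmin⟩, Processes.leaf (by simpa using hf) rfl rfl⟩

/-! ### Depth bound. -/

/-- While the algorithm goes on, some active node of small depth has a fractional job. -/
lemma Invariant.exists_shallow (hε : 0 < ε) {s : State n m} (h : Invariant P s)
    (hs : ¬ Stops P ε s) :
    ∃ w ∈ s.active, (∃ j, Fractional w.vertex j) ∧ NodeInvariant P (makespan P s.best) w ∧
      w.path.length + 1 ≤ ⌊(m : ℝ) ^ 2 / ε⌋₊ := by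
  simp only [Stops, not_or, not_exists, not_and, not_le] at hs
  obtain ⟨hne, hs⟩ := hs
  obtain ⟨_, ⟨w, hw, rfl⟩, hle⟩ : ∃ L, IsLeast (Node.lb '' s.active) L :=
    ⟨_, Nat.sInf_mem ((Set.nonempty_iff_ne_empty.2 hne).image _), fun _ hd => Nat.sInf_le hd⟩
  have hlt := hs w.lb ⟨⟨w, hw, rfl⟩, hle⟩
  have hwi := h.node w hw
  have hlb0 : (0 : ℝ) ≤ w.lb := Nat.cast_nonneg _
  have hf : ∃ j, Fractional w.vertex j := by
    by_contra! hf
    have h1 : (makespan P s.best : ℝ) ≤ w.lb := by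
      exact_mod_cast hwi.le_schedule.trans (hwi.bounded.makespan_le_lb hwi.nodup hf)
    nlinarith
  refine ⟨w, hw, hf, hwi, ?_⟩
  obtain ⟨j, hj⟩ := exists_isBranchingJob (P := P) hf
  have hbig : ∀ j', makespan P s.best ≤ w.lb + m * minTime P j' →
      ε * w.lb < m * minTime P j' := by
    intro j' hj'
    have : (makespan P s.best : ℝ) ≤ w.lb + m * minTime P j' := by exact_mod_cast hj'
    linarith
  have hjbig := hbig j (hwi.le_schedule.trans (hwi.bounded.makespan_le hwi.nodup hj))
  have hpath : ∀ p : Path n m, (∀ z ∈ p, ε * (w.lb : ℝ) < m * minTime P z.1) →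
      p.length * (ε * w.lb) ≤ m * ((p.map fun z => minTime P z.1).sum : ℕ) := by
    intro p hp
    induction p with
    | nil => simp
    | cons z p ih =>
      rw [List.forall_mem_cons] at hp
      have := ih hp.2
      simp only [List.length_cons, List.map_cons, List.sum_cons, Nat.cast_add, Nat.cast_one]
      linarith [hp.1]
  have hsum := hpath w.path fun z hz => hbig z.1 (hwi.le_path z hz)
  have htot : (((w.path.map fun z => minTime P z.1).sum : ℕ) : ℝ) + minTime P j ≤ m * w.lb := by
    exact_mod_cast hwi.bounded.sum_minTime_le (hj.mem_free hwi.bounded)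
  have htot' := mul_le_mul_of_nonneg_left htot (Nat.cast_nonneg (α := ℝ) m)
  -- The branching job supplies both the `+ 1` and the strictness; strictness lets `w.lb` be
  -- cancelled without a separate case `w.lb = 0`.
  have hfin : ((w.path.length + 1 : ℝ) * ε) * w.lb < (m : ℝ) ^ 2 * w.lb := by
    nlinarith
  have hfin' := lt_of_mul_lt_mul_right hfin hlb0
  refine Nat.le_floor ((le_div_iff₀ hε).2 ?_)
  push_cast
  exact hfin'.le

/-! ### Counting processed nodes. -/

/-- The number of nodes of the first `r` levels of an `m`-ary tree. -/
def levels (m r : ℕ) : ℕ := ∑ i ∈ range r, m ^ i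

lemma levels_succ (m r : ℕ) : levels m (r + 1) = m * levels m r + 1 := by
  rw [levels, sum_range_succ', levels, mul_sum]
  simp [pow_succ']

lemma levels_le_pow (hm : 2 ≤ m) (r : ℕ) : levels m r ≤ m ^ r :=
  (Nat.geomSum_lt hm fun _ hk => mem_range.1 hk).le

/-- An active node at depth `d` carries potential `levels m (F - d)`, the size of its full subtree
above depth `F`. Processing trades the potential of `v` for that of at most `m` children. -/
lemma Processes.exists_finset {v : Node n m} {s s' : State n m} (h : Processes P v s s')
    {A : Finset (Node n m)} (hA : s.active = A) (hv : v ∈ s.active) (F : ℕ) :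
    ∃ A' : Finset (Node n m), s'.active = A' ∧
      ∑ w ∈ A', levels m (F - w.path.length) + levels m (F - v.path.length) ≤
        ∑ w ∈ A, levels m (F - w.path.length) + m * levels m (F - (v.path.length + 1)) := by
  classical
  have hvA : v ∈ A := by
    rw [hA] at hv
    exact_mod_cast hv
  have hsum := sum_erase_add A (fun w => levels m (F - w.path.length)) hvA
  cases h with
  | leaf hint hact hbest =>
    exact ⟨A.erase v, by rw [hact, hA, coe_erase], by omega⟩
  | branch j hj c hpath hbd hfound hbest hbestc hact =>
    let C := (univ.image c).filter fun w => w.lb ≤ makespan P s'.best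
    refine ⟨A.erase v ∪ C, ?_, ?_⟩
    · rw [hact, hA]
      ext w
      simp [C, eq_comm, and_comm]
    · have hC : ∑ w ∈ C, levels m (F - w.path.length) ≤
          m * levels m (F - (v.path.length + 1)) := by
        refine (sum_le_card_nsmul C _ (levels m (F - (v.path.length + 1))) fun w hw => ?_).trans ?_
        · obtain ⟨i, -, rfl⟩ := mem_image.1 (mem_filter.1 hw).1
          simp [hpath]
        · rw [smul_eq_mul]
          refine Nat.mul_le_mul_right _ ((card_filter_le _ _).trans (card_image_le.trans ?_))
          simp
      have hU := sum_union_inter (s₁ := A.erase v) (s₂ := C)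
        (f := fun w => levels m (F - w.path.length))
      omega

lemma Run.exists_finset (hε : 0 < ε) {k : ℕ} {s : State n m} (h : Run P ε k s) :
    ∃ A : Finset (Node n m), s.active = A ∧
      k + ∑ w ∈ A, levels m (⌊(m : ℝ) ^ 2 / ε⌋₊ - w.path.length) ≤
        max 1 (levels m ⌊(m : ℝ) ^ 2 / ε⌋₊) := by
  generalize hF : ⌊(m : ℝ) ^ 2 / ε⌋₊ = F
  induction h with
  | first hi hs =>
    obtain ⟨v, ⟨hv, -⟩, hp⟩ := hs
    obtain ⟨r, hr, -, ha, -⟩ := hi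
    obtain ⟨A', hA', hle⟩ := hp.exists_finset (A := {r}) (by simp [ha]) hv F
    rw [ha, Set.mem_singleton_iff] at hv
    subst hv
    refine ⟨A', hA', ?_⟩
    rw [sum_singleton, hr] at hle
    -- The root is processed before any stopping test, so one node is counted even when `F = 0`;
    -- hence the `max 1`.
    cases F with
    | zero => simp [levels]
    | succ F =>
      rw [levels_succ]
      simp at hle
      omega
  | next hrun hns hs ih =>
    obtain ⟨A, hA, hk⟩ := ih
    obtain ⟨v, ⟨hv, hmin⟩, hp⟩ := hs
    obtain ⟨A', hA', hle⟩ := hp.exists_finset hA hv F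
    obtain ⟨w, hw, -, -, hd⟩ := hrun.invariant.exists_shallow hε hns
    have hvw := hmin w hw
    rw [hF] at hd
    refine ⟨A', hA', ?_⟩
    -- `v` is no deeper than the shallow node `w`, so the truncated subtraction is positive and the
    -- potential drops by at least one.
    rw [show F - v.path.length = F - (v.path.length + 1) + 1 by omega, levels_succ] at hle
    omega

lemma Run.le_pow (hm : 0 < m) (hε : 0 < ε) {k : ℕ} {s : State n m} (h : Run P ε k s) :
    k ≤ m ^ ⌊(m : ℝ) ^ 2 / ε⌋₊ := by
  obtain rfl | hm2 : m = 1 ∨ 2 ≤ m := by omega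
  -- For `m = 1`, `levels 1 F = F` is too weak, but a second step would need a fractional job and
  -- hence two distinct machines.
  · cases h with
    | first => simp
    | next hrun hns _ =>
      obtain ⟨w, -, ⟨j, hj⟩, hwi, -⟩ := hrun.invariant.exists_shallow hε hns
      obtain ⟨a, b, hab, -, -⟩ := exists_pair_of_fractional hwi.bounded.isVertex.1 hj
      exact absurd (Subsingleton.elim a b) hab
  · obtain ⟨A, -, hk⟩ := h.exists_finset hε
    have h1 := levels_le_pow hm2 ⌊(m : ℝ) ^ 2 / ε⌋₊
    have h2 := Nat.one_le_pow ⌊(m : ℝ) ^ 2 / ε⌋₊ m hm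
    exact (Nat.le_add_right _ _).trans (hk.trans (max_le h2 h1))

end UnrelSched

/-- Every execution can be started and never gets stuck, processes at most `m ^ ⌊m² / ε⌋` nodes, and
its best schedule when it stops is a `(1 + ε)`-approximation. -/
theorem mainTheorem7 (n m : ℕ) (hm : 0 < m) (P : Fin n → Fin m → ℕ) (ε : ℝ) (hε : 0 < ε) :
    (∃ s, UnrelSched.IsInitial P s) ∧
    (∀ s, UnrelSched.IsInitial P s → ∃ s', UnrelSched.Step P s s') ∧
    (∀ k s, UnrelSched.Run P ε k s → ¬ UnrelSched.Stops P ε s → ∃ s', UnrelSched.Step P s s') ∧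
    (∀ k s, UnrelSched.Run P ε k s → k ≤ m ^ ⌊(m : ℝ) ^ 2 / ε⌋₊) ∧
    (∀ k s, UnrelSched.Run P ε k s → UnrelSched.Stops P ε s →
      ∀ σ : Fin n → Fin m,
        (UnrelSched.makespan P s.best : ℝ) ≤ (1 + ε) * (UnrelSched.makespan P σ : ℝ)) := by
  refine ⟨?_, fun s hs => ?_, fun k s hr hns => ?_, fun k s hr => hr.le_pow hm hε,
    fun k s hr hs => hr.invariant.makespan_le_of_stops hε hs⟩
  · obtain ⟨r, hr, hb⟩ := UnrelSched.exists_isBounded hm P (p := []) List.nodup_nil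
    exact ⟨⟨{r}, r.schedule⟩, r, hr, hb, rfl, rfl⟩
  · obtain ⟨r, -, -, ha, -⟩ := id hs
    exact hs.invariant.exists_step hm (by simp [ha])
  · exact hr.invariant.exists_step hm (Set.nonempty_iff_ne_empty.2 fun h => hns (Or.inl h))
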